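/- Let $n,k\ge 1$ be integers and let $e_{ij}$ ($1\le i,j\le n$) be the matrix units. In the loop algebra $\mathfrak{sl}_n[z,z^{-1}]=\mathfrak{sl}_n(\mathbb{C})\otimes\mathbb{C}[z,z^{-1}]$ put $$P_r=\sum_{i-j=r}e_{ij}+z\sum_{j-i=n-r}e_{ij},\qquad r=1,\dots,n-1,$$ and extend this to all $r\in\mathbb{Z}\setminus n\mathbb{Z}$ by $P_{r+n}=zP_r$. Let the loop algebra act on $\mathbb{C}[z^{\pm1}]\otimes S^k(\mathbb{C}^n)$ by $(f\otimes x)\cdot(g\otimes v_1\cdots v_k)=fg\otimes\sum_{i=1}^k v_1\cdots(x v_i)\cdots v_k$, denote the operator by which $P_r$ acts again by $P_r$, and put $P_{mn}=z^m k\,\mathrm{Id}$ for $m\in\mathbb{Z}$. Let $\mathbb{V}_k(n)\subset\operatorname{End}(\mathbb{C}[z^{\pm1}]\otimes S^k(\mathbb{C}^n))$ be the $\mathbb{C}$-algebra generated by the operators $P_r$, $r\in\mathbb{Z}$. With the power sums $p_r=x_1^r+\dots+x_k^r$, let $$\mathcal{V}_k(n)=\mathbb{C}[z^{\pm1}][x_1,\dots,x_k]^{S_k}\big/\big\langle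 p_n-zk,\;p_{n+1}-zp_1,\;\dots,\;p_{n+k-1}-zp_{k-1}\big\rangle$$ be the generalised Verlinde algebra. Then $\mathbb{V}_k(n)$ is commutative, and there is exactly one isomorphism of $\mathbb{C}$-algebras $\mathbb{V}_k(n)\to\mathcal{V}_k(n)$ such that $P_r\mapsto p_r$ and $P_{-r}\mapsto z^{-1}p_{n-r}$ for $r=1,\dots,n-1$, and $P_{mn}=z^m k\,\mathrm{Id}\mapsto z^m k$ for all $m\in\mathbb{Z}$ (so that the isomorphism is $\mathbb{C}[z^{\pm1}]$-linear). -/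

import Mathlib

open scoped TensorProduct LaurentPolynomial

noncomputable section

namespace GenVerlinde

attribute [local instance 100] LieRing.ofAssociativeRing

theorem symEnd_ext {ι M : Type} [AddCommGroup M] [Module ℂ M]
    {A B : Module.End ℂ (SymmetricPower ℂ ι M)}
    (h : ∀ v : ι → M, A (SymmetricPower.tprod ℂ v) = B (SymmetricPower.tprod ℂ v)) : A = B :=
  LinearMap.ext_on_range (SymmetricPower.span_tprod_eq_top ℂ ι M) h

section Power

variable {ι M : Type} [Fintype ι] [DecidableEq ι] [AddCommGroup M] [Module ℂ M]

/-- The operator `v₁ ⊗ ⋯ ⊗ vₖ ↦ ∑ i, v₁ ⊗ ⋯ ⊗ f vᵢ ⊗ ⋯ ⊗ vₖ` on a tensor power. -/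
def tensorDer (f : Module.End ℂ M) : Module.End ℂ (⨂[ℂ] _ : ι, M) :=
  ∑ i, PiTensorProduct.map (Function.update (fun _ => LinearMap.id) i f)

theorem tensorDer_tprod (f : Module.End ℂ M) (v : ι → M) :
    tensorDer f (PiTensorProduct.tprod ℂ v) =
      ∑ i, PiTensorProduct.tprod ℂ (Function.update v i (f (v i))) := by
  simp only [tensorDer, LinearMap.sum_apply, PiTensorProduct.map_tprod]
  refine Finset.sum_congr rfl fun i _ => ?_
  congr 1
  funext j
  by_cases h : j = i
  · subst h; simp
  · simp [h]

theorem mk_tensorDer_perm (f : Module.End ℂ M) (e : Equiv.Perm ι) (v : ι → M) :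
    SymmetricPower.mk ℂ ι M (tensorDer f (PiTensorProduct.tprod ℂ v)) =
      SymmetricPower.mk ℂ ι M (tensorDer f (PiTensorProduct.tprod ℂ fun i => v (e i))) := by
  rw [tensorDer_tprod, tensorDer_tprod, map_sum, map_sum, ← Equiv.sum_comp e]
  refine Finset.sum_congr rfl fun i _ => ?_
  have h : Function.update (fun j => v (e j)) i (f (v (e i))) =
      fun j => Function.update v (e i) (f (v (e i))) (e j) := by
    funext j
    by_cases h : j = i
    · subst h; simp
    · simp [h]
  rw [h]
  exact (SymmetricPower.tprod_equiv (R := ℂ) e (Function.update v (e i) (f (v (e i))))).symm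

/-- The operator induced by `tensorDer f` on the symmetric power. -/
def symDer (f : Module.End ℂ M) : Module.End ℂ (SymmetricPower ℂ ι M) where
  toFun := AddCon.lift (addConGen (SymmetricPower.Rel ℂ ι M))
    ((SymmetricPower.mk ℂ ι M ∘ₗ tensorDer f).toAddMonoidHom) (by
      rw [AddCon.addConGen_le]
      rintro _ _ ⟨e, v⟩
      exact mk_tensorDer_perm f e v)
  map_add' := map_add _
  map_smul' c x := by
    induction x using AddCon.induction_on with
    | H x => exact map_smul (SymmetricPower.mk ℂ ι M ∘ₗ tensorDer f) c x

theorem symDer_mk (f : Module.End ℂ M) (x : ⨂[ℂ] _ : ι, M) :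
    symDer f (SymmetricPower.mk ℂ ι M x) = SymmetricPower.mk ℂ ι M (tensorDer f x) := rfl

theorem symDer_tprod (f : Module.End ℂ M) (v : ι → M) :
    symDer f (SymmetricPower.tprod ℂ v) =
      ∑ i, SymmetricPower.tprod ℂ (Function.update v i (f (v i))) := by
  change symDer f (SymmetricPower.mk ℂ ι M (PiTensorProduct.tprod ℂ v)) = _
  rw [symDer_mk, tensorDer_tprod, map_sum]
  rfl

/-- `symDer` is a homomorphism of Lie algebras. -/
def symDerHom : Module.End ℂ M →ₗ⁅ℂ⁆ Module.End ℂ (SymmetricPower ℂ ι M) where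
  toFun := symDer
  map_add' f g := symEnd_ext fun v => by
    simp [symDer_tprod, Finset.sum_add_distrib]
  map_smul' c f := symEnd_ext fun v => by
    simp [symDer_tprod, Finset.smul_sum]
  map_lie' {f g} := symEnd_ext fun v => by
    simp only [LieRing.of_associative_ring_bracket, LinearMap.sub_apply, Module.End.mul_apply,
      symDer_tprod, map_sum, MultilinearMap.map_update_sub, Finset.sum_sub_distrib]
    have key : ∀ (a b : Module.End ℂ M),
        (∑ i, ∑ j, SymmetricPower.tprod ℂ (Function.update (Function.update v i (b (v i))) j
          (a (Function.update v i (b (v i)) j)))) =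
        (∑ i, SymmetricPower.tprod ℂ (Function.update v i (a (b (v i))))) +
        ∑ i, ∑ j ∈ Finset.univ.erase i, SymmetricPower.tprod ℂ
          (Function.update (Function.update v i (b (v i))) j (a (v j))) := by
      intro a b
      rw [← Finset.sum_add_distrib]
      refine Finset.sum_congr rfl fun i _ => ?_
      rw [← Finset.add_sum_erase _ _ (Finset.mem_univ i)]
      congr 1
      · simp
      · refine Finset.sum_congr rfl fun j hj => ?_
        rw [Function.update_of_ne (Finset.ne_of_mem_erase hj)]
    rw [key f g, key g f]
    have sw : (∑ i, ∑ j ∈ Finset.univ.erase i, SymmetricPower.tprod ℂ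
          (Function.update (Function.update v i (g (v i))) j (f (v j)))) =
        ∑ i, ∑ j ∈ Finset.univ.erase i, SymmetricPower.tprod ℂ
          (Function.update (Function.update v i (f (v i))) j (g (v j))) := by
      rw [Finset.sum_comm' (t' := Finset.univ) (s' := fun j => Finset.univ.erase j)]
      · refine Finset.sum_congr rfl fun i _ => Finset.sum_congr rfl fun j hj => ?_
        rw [Function.update_comm (Finset.ne_of_mem_erase hj)]
      · intro i j
        simp [ne_comm]
    rw [sw]
    abel

end Power

/-- The special linear Lie algebra `sl_n(ℂ)`. -/
abbrev Sl (n : ℕ) := LieAlgebra.SpecialLinear.sl (Fin n) ℂ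

/-- The symmetric power `S^k(ℂ^n)`. -/
abbrev SymPow (n k : ℕ) := SymmetricPower ℂ (Fin k) (Fin n → ℂ)

/-- The natural representation of `sl_n(ℂ)` on `S^k(ℂ^n)`. -/
def slRep (n k : ℕ) : Sl n →ₗ⁅ℂ⁆ Module.End ℂ (SymPow n k) :=
  (symDerHom.comp (lieEquivMatrix' (R := ℂ) (n := Fin n)).symm.toLieHom).comp
    (LieAlgebra.SpecialLinear.sl (Fin n) ℂ).incl

instance symPowLieRingModule (n k : ℕ) : LieRingModule (Sl n) (SymPow n k) :=
  LieRingModule.compLieHom (SymPow n k) (slRep n k)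

instance symPowLieModule (n k : ℕ) : LieModule ℂ (Sl n) (SymPow n k) :=
  LieModule.compLieHom (SymPow n k) (slRep n k)

theorem lie_tprod (n k : ℕ) (x : Sl n) (v : Fin k → Fin n → ℂ) :
    ⁅x, (SymmetricPower.tprod ℂ v : SymPow n k)⁆ =
      ∑ i, SymmetricPower.tprod ℂ (Function.update v i (x.1.mulVec (v i))) :=
  symDer_tprod _ v

/-- The loop algebra `sl_n[z,z⁻¹] = ℂ[z,z⁻¹] ⊗ sl_n(ℂ)`; the variable `z` is
`LaurentPolynomial.T 1`, and `[f ⊗ x, g ⊗ y] = fg ⊗ [x, y]`. -/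
abbrev LoopSl (n : ℕ) := ℂ[T;T⁻¹] ⊗[ℂ] Sl n

/-- The space `ℂ[z,z⁻¹] ⊗ S^k(ℂ^n)`, a module over the loop algebra through
`(f ⊗ x) · (g ⊗ s) = fg ⊗ (x · s)`. -/
abbrev LoopSym (n k : ℕ) := ℂ[T;T⁻¹] ⊗[ℂ] SymPow n k

theorem loop_lie_tmul (n k : ℕ) (f g : ℂ[T;T⁻¹]) (x : Sl n) (s : SymPow n k) :
    ⁅(f ⊗ₜ[ℂ] x : LoopSl n), (g ⊗ₜ[ℂ] s : LoopSym n k)⁆ = (f * g) ⊗ₜ[ℂ] ⁅x, s⁆ := rfl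

/-- The matrix `∑_{i - j = d} e_{ij}`, for `d ≠ 0`, as an element of `sl_n(ℂ)`. -/
def diagSum (n : ℕ) (d : ℤ) (hd : d ≠ 0) : Sl n :=
  ⟨Matrix.of fun i j => if (i : ℤ) - (j : ℤ) = d then 1 else 0, by
    change Matrix.trace (Matrix.of fun i j : Fin n =>
      if (i : ℤ) - (j : ℤ) = d then (1 : ℂ) else 0) = 0
    simp [Matrix.trace, hd.symm]⟩

/-- The element `P_r = ∑_{i-j=r} e_{ij} + z ∑_{j-i=n-r} e_{ij}` of the loop algebra, for
`0 < r < n`. -/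
def principalBase (n : ℕ) (r : ℤ) (h₀ : 0 < r) (h₁ : r < n) : LoopSl n :=
  (1 : ℂ[T;T⁻¹]) ⊗ₜ[ℂ] diagSum n r h₀.ne' +
    (LaurentPolynomial.T 1 : ℂ[T;T⁻¹]) ⊗ₜ[ℂ] diagSum n (r - n) (sub_ne_zero.2 h₁.ne)

/-- The element `P_r` of the loop algebra for every integer `r` that is not a multiple of `n`,
extended from `0 < r < n` by `P_{r+n} = z P_r`. -/
def principal (n : ℕ) (hn : 1 ≤ n) (r : ℤ) (hr : ¬ (n : ℤ) ∣ r) : LoopSl n :=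
  (LaurentPolynomial.T (r / n) : ℂ[T;T⁻¹]) •
    principalBase n (r % n)
      (lt_of_le_of_ne (Int.emod_nonneg r (by omega)) fun h => hr (Int.dvd_of_emod_eq_zero h.symm))
      (Int.emod_lt_of_pos r (by omega))

open Classical in
/-- The operator `P_r` on `ℂ[z,z⁻¹] ⊗ S^k(ℂ^n)`: the image of the loop algebra element `P_r` if
`n ∤ r`, and `z^m k Id` if `r = m n`. -/
def principalOp (n k : ℕ) (hn : 1 ≤ n) (r : ℤ) : Module.End ℂ[T;T⁻¹] (LoopSym n k) :=
  if hr : (n : ℤ) ∣ r then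
    ((LaurentPolynomial.T (r / n) : ℂ[T;T⁻¹]) * (k : ℂ[T;T⁻¹])) • LinearMap.id
  else
    LieModule.toEnd ℂ[T;T⁻¹] (LoopSl n) (LoopSym n k) (principal n hn r hr)

/-- The complex algebra generated by the operators `P_r`, `r ∈ ℤ`. -/
def principalRing (n k : ℕ) (hn : 1 ≤ n) :
    Subalgebra ℂ (Module.End ℂ[T;T⁻¹] (LoopSym n k)) :=
  Algebra.adjoin ℂ (Set.range (principalOp n k hn))

/-- The operator `P_r` as an element of the ring that these operators generate. -/
def principalGen (n k : ℕ) (hn : 1 ≤ n) (r : ℤ) : principalRing n k hn :=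
  ⟨principalOp n k hn r, Algebra.subset_adjoin ⟨r, rfl⟩⟩

section Quotient

variable (A : Type) [CommRing A]

/-- The power sum `p_r = ∑ x_i^r` in the ring `A[x₁,…,x_k]^{S_k}`; in particular `p_0 = k`. -/
def powerSum (k r : ℕ) : MvPolynomial.symmetricSubalgebra (Fin k) A :=
  ⟨MvPolynomial.psum (Fin k) A r, MvPolynomial.psum_isSymmetric _ _ r⟩

/-- The ideal of `A[x₁,…,x_k]^{S_k}` generated by `p_{n+i} - z p_i`, `0 ≤ i < k`; the first
generator is `p_n - z k`. -/
def verlindeIdeal (z : A) (n k : ℕ) : Ideal (MvPolynomial.symmetricSubalgebra (Fin k) A) :=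
  Ideal.span (Set.range fun i : Fin k => powerSum A k (n + i) - z • powerSum A k i)

/-- The quotient of `A[x₁,…,x_k]^{S_k}` by `verlindeIdeal A z n k`. -/
abbrev VerlindeOver (z : A) (n k : ℕ) : Type :=
  MvPolynomial.symmetricSubalgebra (Fin k) A ⧸ verlindeIdeal A z n k

end Quotient

/-- The generalised Verlinde algebra `ℂ[z,z⁻¹][x₁,…,x_k]^{S_k} / (p_{n+i} - z p_i : 0 ≤ i < k)`. -/
def Verlinde (n k : ℕ) : Type := VerlindeOver ℂ[T;T⁻¹] (LaurentPolynomial.T 1) n k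

instance (n k : ℕ) : CommRing (Verlinde n k) :=
  inferInstanceAs (CommRing (VerlindeOver ℂ[T;T⁻¹] (LaurentPolynomial.T 1) n k))

instance (n k : ℕ) : Algebra ℂ[T;T⁻¹] (Verlinde n k) :=
  inferInstanceAs (Algebra ℂ[T;T⁻¹] (VerlindeOver ℂ[T;T⁻¹] (LaurentPolynomial.T 1) n k))

instance (n k : ℕ) : Algebra ℂ (Verlinde n k) :=
  inferInstanceAs (Algebra ℂ (VerlindeOver ℂ[T;T⁻¹] (LaurentPolynomial.T 1) n k))

instance (n k : ℕ) : IsScalarTower ℂ ℂ[T;T⁻¹] (Verlinde n k) :=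
  inferInstanceAs
    (IsScalarTower ℂ ℂ[T;T⁻¹] (VerlindeOver ℂ[T;T⁻¹] (LaurentPolynomial.T 1) n k))

/-- The class of the power sum `p_r` in the generalised Verlinde algebra. -/
def pClass (n k r : ℕ) : Verlinde n k :=
  Ideal.Quotient.mk (verlindeIdeal ℂ[T;T⁻¹] (LaurentPolynomial.T 1) n k)
    (powerSum ℂ[T;T⁻¹] k r)

end GenVerlinde

end

/-! Write A = ℂ[z,z⁻¹]. The A-linear map `monMap` from A[x₁,…,x_k] onto A ⊗ S^k(ℂ^n) sends x^a to
z^(∑⌊a_i/n⌋) ⊗ ∏ e_(a_i mod n). It turns multiplication by p_r into P_r (`monMap_psum_mul`), since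
P_r shifts an index cyclically by r and the powers of z count the turns. Power sums generate the
symmetric polynomials over a ℚ-algebra (`adjoin_powerSum`), so these act on A ⊗ S^k(ℂ^n) through a
homomorphism `symAct`. Its image is the ring generated by the P_r, which is therefore commutative.

It remains to find the kernel (`symAct_eq_zero_iff`). The relation P_(r+n) = z P_r kills the
Verlinde ideal. Conversely, if f acts by zero then `monMap` kills f, and symmetrizing back into
polynomials puts k!·f, hence f, in the ideal (x_i^n - z) (`symmetrize_monMap_sub_mem`). Summing an
element of that ideal over all permutations gives an element of the Verlinde ideal
(`permSum_mem_verlindeSubmodule`), by a recursion on augmented monomial symmetric functions. For the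
symmetric f this sum is again k!·f.

Uniqueness holds because k is invertible, so the P_r with 0 < r < n and the P_(mn) already generate
(`principalRing_algHom_ext`). -/

open scoped TensorProduct LaurentPolynomial

noncomputable section

namespace GenVerlinde

/-! ### Symmetric polynomials and the contraction of the ideal (x_i^n - z). -/

section SymmetricFunctions

open MvPolynomial

variable {A : Type} [CommRing A]

/-- Over a `ℚ`-algebra the power sums generate the ring of symmetric polynomials. -/
theorem adjoin_powerSum [Algebra ℚ A] (k : ℕ) :
    Algebra.adjoin A (Set.range (powerSum A k)) = ⊤ := by
  set S := Algebra.adjoin A (Set.range (powerSum A k))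
  have hp : ∀ r, powerSum A k r ∈ S := fun r => Algebra.subset_adjoin ⟨r, rfl⟩
  have hS : ∀ f : symmetricSubalgebra (Fin k) A,
      (f : MvPolynomial (Fin k) A) ∈ S.map (symmetricSubalgebra (Fin k) A).val → f ∈ S := by
    rintro f ⟨g, hg, h⟩
    rwa [← Subtype.ext h]
  have hp' : ∀ r, psum (Fin k) A r ∈ S.map (symmetricSubalgebra (Fin k) A).val :=
    fun r => ⟨_, hp r, rfl⟩
  generalize S.map (symmetricSubalgebra (Fin k) A).val = S' at hS hp'
  have he' : ∀ m, esymm (Fin k) A m ∈ S' := by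
    intro m
    induction m using Nat.strong_induction_on with
    | _ m ih =>
    rcases Nat.eq_zero_or_pos m with rfl | hm
    · rw [esymm_zero]
      exact S'.one_mem
    -- Newton's identity expresses m·e_m through power sums and e_a with a < m; dividing by m is
    -- where ℚ ⊆ A enters.
    · have key : (m : MvPolynomial (Fin k) A) * esymm (Fin k) A m ∈ S' := by
        rw [mul_esymm_eq_sum]
        exact S'.mul_mem (S'.pow_mem (S'.neg_mem S'.one_mem) _)
          (S'.sum_mem fun a ha => S'.mul_mem (S'.mul_mem (S'.pow_mem (S'.neg_mem S'.one_mem) _)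
            (ih _ (Finset.mem_filter.1 ha).2)) (hp' _))
      have h := S'.smul_mem key (algebraMap ℚ A (1 / m))
      rwa [← nsmul_eq_mul, ← Nat.cast_smul_eq_nsmul A, smul_smul, ← map_natCast (algebraMap ℚ A),
        ← map_mul, one_div, inv_mul_cancel₀ (by exact_mod_cast hm.ne'), map_one, one_smul] at h
  have he : ∀ m, (⟨esymm (Fin k) A m, esymm_isSymmetric (Fin k) A m⟩ :
      symmetricSubalgebra (Fin k) A) ∈ S := fun m => hS _ (he' m)
  rw [eq_top_iff]
  rintro f -
  obtain ⟨g, rfl⟩ := esymmAlgHom_surjective (σ := Fin k) A (n := k) (by simp) f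
  rw [esymmAlgHom]
  induction g using MvPolynomial.induction_on with
  | C r => rw [aeval_C]; exact S.algebraMap_mem r
  | add p q hp hq => rw [map_add]; exact S.add_mem hp hq
  | mul_X p i hp => rw [map_mul, aeval_X]; exact S.mul_mem hp (he _)

variable (z : A) (n k : ℕ)

/-- The image of `verlindeIdeal` in the polynomial ring. -/
def verlindeSubmodule : Submodule (symmetricSubalgebra (Fin k) A) (MvPolynomial (Fin k) A) :=
  Submodule.map (Algebra.linearMap (symmetricSubalgebra (Fin k) A) (MvPolynomial (Fin k) A))
    (verlindeIdeal A z n k)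

variable {z n k}

theorem coe_mem_verlindeSubmodule {f : symmetricSubalgebra (Fin k) A} :
    (f : MvPolynomial (Fin k) A) ∈ verlindeSubmodule z n k ↔ f ∈ verlindeIdeal A z n k := by
  constructor
  · rintro ⟨g, hg, h⟩
    rwa [← Subtype.ext h]
  · exact fun h => ⟨f, h, rfl⟩

theorem mul_mem_verlindeSubmodule {f g : MvPolynomial (Fin k) A} (hf : f.IsSymmetric)
    (hg : g ∈ verlindeSubmodule z n k) : f * g ∈ verlindeSubmodule z n k :=
  (verlindeSubmodule z n k).smul_mem (⟨f, hf⟩ : symmetricSubalgebra (Fin k) A) hg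

/-- Each variable is a root of the monic polynomial with roots `x₁, …, x_k`. -/
theorem X_pow_card_eq (i : Fin k) :
    (X i : MvPolynomial (Fin k) A) ^ k =
      -∑ j ∈ Finset.range k, (-1) ^ (j + 1) * (esymm (Fin k) A (j + 1) * X i ^ (k - (j + 1))) := by
  have h := congrArg (Polynomial.eval (X i : MvPolynomial (Fin k) A))
    (Multiset.prod_X_sub_X_eq_sum_esymm
      (Finset.univ.val.map (X : Fin k → MvPolynomial (Fin k) A)))
  rw [Multiset.map_map, Polynomial.eval_multiset_prod, Multiset.map_map,
    Multiset.prod_eq_zero] at h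
  · simp only [Multiset.card_map, Finset.card_val, Finset.card_univ, Fintype.card_fin,
      Finset.sum_range_succ', ← esymm_eq_multiset_esymm] at h
    simp [Polynomial.eval_finsetSum] at h
    rw [eq_neg_iff_add_eq_zero, add_comm]
    exact h.symm
  · exact Multiset.mem_map.2 ⟨i, by simp, by simp⟩

/-- The k generators of the ideal force p_(n+m) - z p_m into it for every m: for m ≥ k,
`X_pow_card_eq` gives a recursion of length k whose coefficients are symmetric, so the ideal absorbs
them. -/
theorem psum_sub_mem_verlindeSubmodule (m : ℕ) :
    ∑ i, (X i : MvPolynomial (Fin k) A) ^ m * (X i ^ n - C z) ∈ verlindeSubmodule z n k := by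
  induction m using Nat.strong_induction_on with
  | _ m ih =>
  rcases lt_or_ge m k with hm | hm
  · have h : powerSum A k (n + m) - z • powerSum A k m ∈ verlindeIdeal A z n k :=
      Ideal.subset_span ⟨⟨m, hm⟩, rfl⟩
    rw [← coe_mem_verlindeSubmodule] at h
    have e : ∑ i, (X i : MvPolynomial (Fin k) A) ^ m * (X i ^ n - C z) =
        psum (Fin k) A (n + m) - z • psum (Fin k) A m := by
      rw [psum, psum, Finset.smul_sum, ← Finset.sum_sub_distrib]
      refine Finset.sum_congr rfl fun i _ => ?_
      rw [MvPolynomial.smul_eq_C_mul, pow_add, mul_sub]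
      congr 1 <;> exact mul_comm _ _
    rw [e]
    exact h
  · obtain ⟨d, rfl⟩ := Nat.exists_eq_add_of_le hm
    have h : ∑ i, (X i : MvPolynomial (Fin k) A) ^ (k + d) * (X i ^ n - C z) =
        -∑ j ∈ Finset.range k, ((-1) ^ (j + 1) * esymm (Fin k) A (j + 1)) *
          ∑ i, X i ^ (k - (j + 1) + d) * (X i ^ n - C z) := by
      simp only [pow_add _ _ d, X_pow_card_eq, Finset.mul_sum, neg_mul, Finset.sum_mul,
        Finset.sum_neg_distrib]
      rw [Finset.sum_comm]
      refine congrArg Neg.neg (Finset.sum_congr rfl fun j _ => Finset.sum_congr rfl fun i _ => ?_)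
      ring
    rw [h]
    refine neg_mem (sum_mem fun j hj => ?_)
    rw [mul_assoc]
    have hj' := Finset.mem_range.1 hj
    have h1 := mul_mem_verlindeSubmodule (esymm_isSymmetric (Fin k) A (j + 1))
      (ih (k - (j + 1) + d) (by omega))
    rcases neg_one_pow_eq_or (MvPolynomial (Fin k) A) (j + 1) with h2 | h2
    · rw [h2, one_mul]
      exact h1
    · rw [h2, neg_one_mul]
      exact neg_mem h1

theorem sum_aeval_X_mem_verlindeSubmodule {q : Polynomial A}
    (hq : Polynomial.X ^ n - Polynomial.C z ∣ q) :
    ∑ i, Polynomial.aeval (X i : MvPolynomial (Fin k) A) q ∈ verlindeSubmodule z n k := by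
  obtain ⟨r, rfl⟩ := hq
  induction r using Polynomial.induction_on' with
  | add p q hp hq =>
    simp only [mul_add, map_add, Finset.sum_add_distrib]
    exact add_mem hp hq
  | monomial m a =>
    have := mul_mem_verlindeSubmodule (IsSymmetric.C a)
      (psum_sub_mem_verlindeSubmodule (z := z) (n := n) (k := k) m)
    convert this using 1
    rw [Finset.mul_sum]
    refine Finset.sum_congr rfl fun i _ => ?_
    simp [Polynomial.aeval_monomial]
    ring

theorem sum_aeval_X_isSymmetric (q : Polynomial A) :
    (∑ i, Polynomial.aeval (X i : MvPolynomial (Fin k) A) q).IsSymmetric := by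
  intro e
  rw [map_sum, ← Equiv.sum_comp e (fun i => Polynomial.aeval (X i : MvPolynomial (Fin k) A) q)]
  refine Finset.sum_congr rfl fun i _ => ?_
  rw [← Polynomial.aeval_algHom_apply, rename_X]

/-- The augmented monomial symmetric function attached to a family of univariate polynomials. -/
def augSum (k : ℕ) {m : ℕ} (q : Fin m → Polynomial A) : MvPolynomial (Fin k) A :=
  ∑ e : Fin m ↪ Fin k, ∏ l, Polynomial.aeval (X (e l)) (q l)

/-- Let the image of 0 range over all of `Fin k`, then subtract the cases where it collides with the
image of another index l; there the two univariate factors merge. -/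
theorem augSum_succ {m : ℕ} (q : Fin (m + 1) → Polynomial A) :
    augSum k q = (∑ i, Polynomial.aeval (X i : MvPolynomial (Fin k) A) (q 0)) *
        augSum k (fun l => q l.succ) -
      ∑ l, augSum k (Function.update (fun l => q l.succ) l (q l.succ * q 0)) := by
  classical
  rw [augSum, ← Equiv.sum_comp (Equiv.embeddingFinSucc m (Fin k)).symm, Fintype.sum_sigma]
  simp only [augSum]
  rw [Finset.sum_comm, Finset.mul_sum, ← Finset.sum_sub_distrib]
  refine Finset.sum_congr rfl fun e _ => ?_
  have h1 : ∀ x : {i // i ∉ Set.range e},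
      (∏ l, Polynomial.aeval (X ((Equiv.embeddingFinSucc m (Fin k)).symm ⟨e, x⟩ l) :
        MvPolynomial (Fin k) A) (q l)) =
      Polynomial.aeval (X x.1) (q 0) * ∏ l, Polynomial.aeval (X (e l)) (q l.succ) := by
    intro x
    rw [Fin.prod_univ_succ]
    simp
  have h2 : ∀ l : Fin m, (∏ j, Polynomial.aeval (X (e j) : MvPolynomial (Fin k) A)
        (Function.update (fun l => q l.succ) l (q l.succ * q 0) j)) =
      Polynomial.aeval (X (e l)) (q 0) * ∏ l, Polynomial.aeval (X (e l)) (q l.succ) := by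
    intro l
    rw [← Finset.mul_prod_erase _ _ (Finset.mem_univ l),
      ← Finset.mul_prod_erase _ (fun l => Polynomial.aeval (X (e l)) (q l.succ))
        (Finset.mem_univ l)]
    have : ∀ j ∈ Finset.univ.erase l, Polynomial.aeval (X (e j) : MvPolynomial (Fin k) A)
        (Function.update (fun l => q l.succ) l (q l.succ * q 0) j) =
        Polynomial.aeval (X (e j)) (q j.succ) := fun j hj => by
      rw [Function.update_of_ne (Finset.ne_of_mem_erase hj)]
    rw [Finset.prod_congr rfl this, Function.update_self, map_mul]
    ring
  simp only [h1, h2, ← Finset.sum_mul, ← sub_mul]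
  congr 1
  rw [eq_sub_iff_add_eq, ← Finset.sum_subtype (Finset.univ.filter fun i => i ∉ Set.range e)
    (by simp) (fun i => Polynomial.aeval (X i : MvPolynomial (Fin k) A) (q 0)),
    ← Finset.sum_filter_add_sum_filter_not Finset.univ (fun i => i ∉ Set.range e)]
  congr 1
  rw [← Finset.sum_map Finset.univ e
    (fun i => Polynomial.aeval (X i : MvPolynomial (Fin k) A) (q 0))]
  refine Finset.sum_congr ?_ fun _ _ => rfl
  ext i
  simp

/-- In the recursion `augSum_succ` the factor divisible by X^n - z is either split off as a single
sum over the variables, which lies in the ideal, or stays, possibly merged, in an `augSum` with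
fewer factors. -/
theorem augSum_mem_verlindeSubmodule {m : ℕ} (q : Fin m → Polynomial A) (s : Fin m)
    (hs : Polynomial.X ^ n - Polynomial.C z ∣ q s) : augSum k q ∈ verlindeSubmodule z n k := by
  induction m with
  | zero => exact s.elim0
  | succ m ih =>
  rw [augSum_succ]
  induction s using Fin.cases with
  | zero =>
    refine sub_mem ?_ (sum_mem fun l _ => ih _ l ?_)
    · rw [mul_comm]
      refine mul_mem_verlindeSubmodule ?_ (sum_aeval_X_mem_verlindeSubmodule hs)
      -- The cofactor must be symmetric: a permutation of the variables only permutes the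
      -- embeddings.
      intro e
      rw [augSum, map_sum, ← Equiv.sum_comp (Equiv.embeddingCongr (Equiv.refl (Fin m)) e)
        (fun x : Fin m ↪ Fin k => ∏ l, Polynomial.aeval (X (x l) : MvPolynomial (Fin k) A)
          (q l.succ))]
      refine Finset.sum_congr rfl fun x _ => ?_
      rw [map_prod]
      refine Finset.prod_congr rfl fun l _ => ?_
      rw [← Polynomial.aeval_algHom_apply, rename_X]
      rfl
    · rw [Function.update_self]
      exact hs.mul_left _
  | succ s =>
    refine sub_mem (mul_mem_verlindeSubmodule (sum_aeval_X_isSymmetric _) (ih _ s hs))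
      (sum_mem fun l _ => ih _ s ?_)
    by_cases h : s = l
    · subst h
      rw [Function.update_self]
      exact hs.mul_right _
    · rwa [Function.update_of_ne h]

variable (z n k) in
/-- The ideal `(x_i ^ n - z : 1 ≤ i ≤ k)`. -/
def rootIdeal : Ideal (MvPolynomial (Fin k) A) :=
  Ideal.span (Set.range fun i : Fin k => X i ^ n - C z)

variable (A k) in
/-- The sum of all permutations of a polynomial. -/
def permSum : MvPolynomial (Fin k) A →ₗ[A] MvPolynomial (Fin k) A :=
  ∑ e : Equiv.Perm (Fin k), (rename e).toLinearMap

theorem permSum_apply (f : MvPolynomial (Fin k) A) :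
    permSum A k f = ∑ e : Equiv.Perm (Fin k), rename e f := by
  simp [permSum]

theorem permSum_prod (q : Fin k → Polynomial A) :
    permSum A k (∏ l, Polynomial.aeval (X l) (q l)) = augSum k q := by
  rw [permSum_apply, augSum, ← Equiv.sum_comp (Equiv.embeddingEquivOfFinite (Fin k)).symm]
  refine Finset.sum_congr rfl fun e _ => ?_
  rw [map_prod]
  refine Finset.prod_congr rfl fun l _ => ?_
  rw [← Polynomial.aeval_algHom_apply, rename_X]
  rfl

/-- For a monomial g the argument is a product of univariate polynomials, one per variable, so its
symmetrization is an `augSum` whose factor at i is divisible by X^n - z. -/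
theorem permSum_mul_mem_verlindeSubmodule (g : MvPolynomial (Fin k) A) (i : Fin k) :
    permSum A k (g * (X i ^ n - C z)) ∈ verlindeSubmodule z n k := by
  classical
  induction g using MvPolynomial.induction_on' with
  | add p q hp hq =>
    rw [add_mul, map_add]
    exact add_mem hp hq
  | monomial a c =>
    have h : monomial a c * (X i ^ n - C z) = c • ∏ l, Polynomial.aeval (X l) (Function.update
        (fun l => (Polynomial.X : Polynomial A) ^ a l) i
        (Polynomial.X ^ a i * (Polynomial.X ^ n - Polynomial.C z)) l) := by
      rw [monomial_eq, Finsupp.prod_fintype _ _ (by simp), MvPolynomial.smul_eq_C_mul, mul_assoc,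
        ← Finset.mul_prod_erase _ _ (Finset.mem_univ i),
        ← Finset.mul_prod_erase _ (fun l => Polynomial.aeval (X l : MvPolynomial (Fin k) A) _)
          (Finset.mem_univ i), Function.update_self]
      have : ∀ j ∈ Finset.univ.erase i, Polynomial.aeval (X j : MvPolynomial (Fin k) A)
          (Function.update (fun l => (Polynomial.X : Polynomial A) ^ a l) i
            (Polynomial.X ^ a i * (Polynomial.X ^ n - Polynomial.C z)) j) = X j ^ a j :=
        fun j hj => by rw [Function.update_of_ne (Finset.ne_of_mem_erase hj)]; simp
      rw [Finset.prod_congr rfl this]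
      simp [algebraMap_eq]
      ring
    rw [h, map_smul, permSum_prod, MvPolynomial.smul_eq_C_mul]
    refine mul_mem_verlindeSubmodule (IsSymmetric.C c) (augSum_mem_verlindeSubmodule _ i ?_)
    rw [Function.update_self]
    exact dvd_mul_left _ _

theorem permSum_mem_verlindeSubmodule {f : MvPolynomial (Fin k) A}
    (hf : f ∈ rootIdeal z n k) : permSum A k f ∈ verlindeSubmodule z n k := by
  rw [rootIdeal, Ideal.mem_span_range_iff_exists_fun] at hf
  obtain ⟨c, rfl⟩ := hf
  rw [map_sum]
  exact sum_mem fun i _ => permSum_mul_mem_verlindeSubmodule _ i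

/-- Contracting `rootIdeal` to the symmetric polynomials gives `verlindeIdeal`. -/
theorem mem_verlindeIdeal_of_permSum_mem [Algebra ℚ A] {f : symmetricSubalgebra (Fin k) A}
    (hf : permSum A k f ∈ rootIdeal z n k) : f ∈ verlindeIdeal A z n k := by
  have key : ∀ m : ℕ, m ≠ 0 → ∀ g : MvPolynomial (Fin k) A,
      (algebraMap ℚ A (1 / m)) • (m • g) = g := fun m hm g => by
    rw [← Nat.cast_smul_eq_nsmul A, smul_smul, ← map_natCast (algebraMap ℚ A),
        ← map_mul, one_div, inv_mul_cancel₀ (by exact_mod_cast hm), map_one, one_smul]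
  have hs : permSum A k f = k.factorial • (f : MvPolynomial (Fin k) A) := by
    rw [permSum_apply, Finset.sum_congr rfl fun e _ => f.2 e]
    simp [Fintype.card_perm]
  have h1 : (f : MvPolynomial (Fin k) A) ∈ rootIdeal z n k := by
    rw [← key _ k.factorial_ne_zero f, ← hs, MvPolynomial.smul_eq_C_mul]
    exact Ideal.mul_mem_left _ _ hf
  -- Average a second time: f is now known to lie in `rootIdeal`, and f = (1/k!)·`permSum` f.
  rw [← coe_mem_verlindeSubmodule, ← key _ k.factorial_ne_zero f, ← hs,
    MvPolynomial.smul_eq_C_mul]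
  exact mul_mem_verlindeSubmodule (IsSymmetric.C _) (permSum_mem_verlindeSubmodule h1)

end SymmetricFunctions

/-! ### The operators P_r as multiplication by power sums. -/

section Operators

variable {n k : ℕ} (hn : 1 ≤ n)

/-- The basis vector of `ℂ^n` whose index is the residue of `a`. -/
def resVec (a : ℕ) : Fin n → ℂ := Pi.single ⟨a % n, Nat.mod_lt a hn⟩ 1

/-- The vector of `ℂ[z,z⁻¹] ⊗ S^k(ℂ^n)` that corresponds to the monomial `x^a`. -/
def monVec (a : Fin k → ℕ) : LoopSym n k :=
  (LaurentPolynomial.T (∑ i, ((a i / n : ℕ) : ℤ)) : ℂ[T;T⁻¹]) ⊗ₜ[ℂ]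
    SymmetricPower.tprod ℂ fun i => resVec hn (a i)

theorem monVec_update (a : Fin k → ℕ) (i : Fin k) (b : ℕ) :
    monVec hn (Function.update a i b) =
      (LaurentPolynomial.T (((b / n : ℕ) : ℤ) - (a i / n : ℕ) + ∑ i, ((a i / n : ℕ) : ℤ)) :
        ℂ[T;T⁻¹]) ⊗ₜ[ℂ]
      SymmetricPower.tprod ℂ (Function.update (fun i => resVec hn (a i)) i (resVec hn b)) := by
  rw [monVec]
  congr 2
  · rw [← Finset.add_sum_erase _ _ (Finset.mem_univ i),
      ← Finset.add_sum_erase _ (fun i => ((a i / n : ℕ) : ℤ)) (Finset.mem_univ i),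
      Function.update_self, Finset.sum_congr rfl (fun j hj => by
        rw [Function.update_of_ne (Finset.ne_of_mem_erase hj)] :
        ∀ j ∈ Finset.univ.erase i, ((Function.update a i b j / n : ℕ) : ℤ) = (a j / n : ℕ))]
    ring
  · funext j
    by_cases h : j = i
    · subst h; simp
    · simp [h]

theorem monVec_update_add_mul (a : Fin k → ℕ) (i : Fin k) (m : ℕ) :
    monVec hn (Function.update a i (a i + n * m)) =
      (LaurentPolynomial.T m : ℂ[T;T⁻¹]) • monVec hn a := by
  rw [monVec_update, monVec, TensorProduct.smul_tmul', smul_eq_mul, ← LaurentPolynomial.T_add]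
  have h : resVec hn (a i + n * m) = resVec hn (a i) := by simp [resVec]
  rw [h, Function.update_eq_self, Nat.add_mul_div_left _ _ hn]
  congr 2
  push_cast
  ring

theorem diagSum_mulVec (s : ℤ) (hs : s ≠ 0) (a b : ℕ)
    (h : ((a % n : ℕ) : ℤ) + s = (b % n : ℕ)) :
    (diagSum n s hs).1.mulVec (resVec hn a) = resVec hn b := by
  funext i
  simp only [diagSum, resVec, Matrix.mulVec_single_one, Matrix.col_apply, Matrix.of_apply,
    Pi.single_apply, Fin.ext_iff]
  congr 1
  simp only [eq_iff_iff]
  omega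

theorem diagSum_mulVec_eq_zero (s : ℤ) (hs : s ≠ 0) (a : ℕ)
    (h : ((a % n : ℕ) : ℤ) + s < 0 ∨ n ≤ ((a % n : ℕ) : ℤ) + s) :
    (diagSum n s hs).1.mulVec (resVec hn a) = 0 := by
  funext i
  simp only [diagSum, resVec, Matrix.mulVec_single_one, Matrix.col_apply, Matrix.of_apply,
    Pi.zero_apply]
  rw [if_neg]
  have := i.2
  omega

/-- Writing a_i = n·⌊a_i/n⌋ + (a_i mod n), the operator P_r is addition with carry: the residue
moves cyclically, and the quotient is the exponent of z. -/
theorem principalOp_monVec (r : ℕ) (a : Fin k → ℕ) :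
    principalOp n k hn r (monVec hn a) = ∑ i, monVec hn (Function.update a i (a i + r)) := by
  by_cases hr : (n : ℤ) ∣ r
  · obtain ⟨m, rfl⟩ := Int.natCast_dvd_natCast.1 hr
    rw [principalOp, dif_pos hr]
    simp only [monVec_update_add_mul, Finset.sum_const, Finset.card_univ, Fintype.card_fin,
      LinearMap.smul_apply, LinearMap.id_apply]
    rw [← Nat.cast_smul_eq_nsmul ℂ[T;T⁻¹], smul_smul, mul_comm]
    congr 3
    push_cast
    exact Int.mul_ediv_cancel_left _ (by omega)
  · rw [principalOp, dif_neg hr, principal, map_smul, LinearMap.smul_apply,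
      LieModule.toEnd_apply_apply, principalBase, add_lie, monVec, loop_lie_tmul,
      loop_lie_tmul, lie_tprod,
      lie_tprod, TensorProduct.tmul_sum,
      TensorProduct.tmul_sum, ← Finset.sum_add_distrib, Finset.smul_sum]
    refine Finset.sum_congr rfl fun i _ => ?_
    rw [monVec_update, one_mul, ← LaurentPolynomial.T_add, smul_add, TensorProduct.smul_tmul',
      TensorProduct.smul_tmul', smul_eq_mul, smul_eq_mul, ← LaurentPolynomial.T_add,
      ← LaurentPolynomial.T_add]
    have h0 : (r : ℤ) / n = (r / n : ℕ) := by simp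
    have h1 : (r : ℤ) % n = (r % n : ℕ) := by simp
    have h2 : r % n < n := Nat.mod_lt _ hn
    have h3 : a i % n < n := Nat.mod_lt _ hn
    -- Exactly one of the two diagonals of P_r acts nontrivially on this basis vector: the one
    -- without z if there is no carry, the one with z if there is.
    rcases lt_or_ge (a i % n + r % n) n with h | h
    · have h4 : (a i + r) % n = a i % n + r % n := Nat.add_mod_of_add_mod_lt h
      have h5 : (a i + r) / n = a i / n + r / n := Nat.add_div_eq_of_add_mod_lt h
      rw [diagSum_mulVec hn _ _ _ (a i + r) (by omega),
        diagSum_mulVec_eq_zero hn _ _ _ (by omega), MultilinearMap.map_update_zero,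
        TensorProduct.tmul_zero, add_zero, h0, h5]
      congr 2
      push_cast
      ring
    · have h4 : (a i + r) % n + n = a i % n + r % n := Nat.add_mod_add_of_le_add_mod h
      have h5 : (a i + r) / n = a i / n + r / n + 1 := Nat.add_div_eq_of_le_mod_add_mod h hn
      rw [diagSum_mulVec_eq_zero hn (r % n) _ _ (by omega),
        diagSum_mulVec hn _ _ _ (a i + r) (by omega), MultilinearMap.map_update_zero,
        TensorProduct.tmul_zero, zero_add, h0, h5]
      congr 2
      push_cast
      ring

theorem principalBase_congr {r s : ℤ} (h : r = s) (h₀ : 0 < r) (h₁ : r < n) :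
    principalBase n r h₀ h₁ = principalBase n s (h ▸ h₀) (h ▸ h₁) := by
  subst h
  rfl

theorem principalOp_add_mul (r m : ℤ) :
    principalOp n k hn (r + m * n) =
      (LaurentPolynomial.T m : ℂ[T;T⁻¹]) • principalOp n k hn r := by
  have hn' : (n : ℤ) ≠ 0 := by omega
  have hdiv : (r + m * n) / n = m + r / n := by
    rw [Int.add_mul_ediv_right _ _ hn', add_comm]
  by_cases hr : (n : ℤ) ∣ r
  · rw [principalOp, principalOp, dif_pos hr, dif_pos (hr.add (Dvd.intro_left _ rfl)), smul_smul,
      hdiv, LaurentPolynomial.T_add, mul_assoc]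
  · have hr' : ¬ (n : ℤ) ∣ r + m * n := by
      rwa [Int.dvd_add_left (Dvd.intro_left _ rfl)]
    rw [principalOp, principalOp, dif_neg hr, dif_neg hr', principal, principal,
      principalBase_congr (Int.add_mul_emod_self_right r m n), hdiv, LaurentPolynomial.T_add,
      mul_smul, map_smul]

theorem principalOp_mul (m : ℤ) :
    principalOp n k hn (m * n) =
      ((LaurentPolynomial.T m : ℂ[T;T⁻¹]) * (k : ℂ[T;T⁻¹])) • LinearMap.id := by
  rw [principalOp, dif_pos (Dvd.intro_left _ rfl), Int.mul_ediv_cancel _ (by omega)]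

variable (k) in
/-- The linear map `ℂ[z,z⁻¹][x₁,…,x_k] → ℂ[z,z⁻¹] ⊗ S^k(ℂ^n)` with `x^a ↦ monVec a`. -/
def monMap : MvPolynomial (Fin k) ℂ[T;T⁻¹] →ₗ[ℂ[T;T⁻¹]] LoopSym n k :=
  (MvPolynomial.basisMonomials (Fin k) ℂ[T;T⁻¹]).constr ℂ[T;T⁻¹] fun a => monVec hn a

theorem monMap_monomial (a : Fin k →₀ ℕ) (c : ℂ[T;T⁻¹]) :
    monMap k hn (MvPolynomial.monomial a c) = c • monVec hn a := by
  have h : MvPolynomial.monomial a c =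
      c • MvPolynomial.basisMonomials (Fin k) ℂ[T;T⁻¹] a := by
    simp [MvPolynomial.smul_monomial]
  rw [h, map_smul, monMap, Module.Basis.constr_basis]

theorem monMap_psum_mul (r : ℕ) (f : MvPolynomial (Fin k) ℂ[T;T⁻¹]) :
    monMap k hn (MvPolynomial.psum (Fin k) ℂ[T;T⁻¹] r * f) =
      principalOp n k hn r (monMap k hn f) := by
  induction f using MvPolynomial.induction_on' with
  | add p q hp hq => rw [mul_add, map_add, map_add, map_add, hp, hq]
  | monomial a c =>
    rw [monMap_monomial, map_smul, principalOp_monVec, MvPolynomial.psum, Finset.sum_mul, map_sum,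
      Finset.smul_sum]
    refine Finset.sum_congr rfl fun i _ => ?_
    rw [MvPolynomial.X_pow_eq_monomial, MvPolynomial.monomial_mul, one_mul, monMap_monomial]
    congr 2
    funext j
    by_cases h : j = i
    · subst h; simp [add_comm]
    · simp [h]

theorem monMap_surjective : Function.Surjective (monMap k hn) := by
  rw [← LinearMap.range_eq_top, eq_top_iff]
  set R := LinearMap.range (monMap k hn)
  -- Showing that this map to the quotient vanishes reduces surjectivity to tensors of basis
  -- vectors, by multilinearity over ℂ.
  let g : SymPow n k →ₗ[ℂ] LoopSym n k ⧸ R :=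
    (R.mkQ.restrictScalars ℂ) ∘ₗ (TensorProduct.mk ℂ ℂ[T;T⁻¹] (SymPow n k) 1)
  have hg : g = 0 := by
    refine LinearMap.ext_on_range (SymmetricPower.span_tprod_eq_top ℂ (Fin k) (Fin n → ℂ)) ?_
    have h : g.compMultilinearMap (SymmetricPower.tprod ℂ) = 0 := by
      refine Module.Basis.ext_multilinear (fun _ => Pi.basisFun ℂ (Fin n)) fun b => ?_
      change R.mkQ ((1 : ℂ[T;T⁻¹]) ⊗ₜ SymmetricPower.tprod ℂ fun i => _) = 0
      rw [Submodule.mkQ_apply, Submodule.Quotient.mk_eq_zero]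
      -- All exponents are below n, so no power of z appears.
      refine ⟨MvPolynomial.monomial (Finsupp.equivFunOnFinite.symm fun i => (b i : ℕ)) 1, ?_⟩
      rw [monMap_monomial, one_smul, monVec]
      congr 2
      · simp [Nat.div_eq_of_lt (b _).2]
      · funext i
        simp only [resVec, Pi.basisFun_apply, Finsupp.equivFunOnFinite_symm_apply_apply]
        congr 1
        ext
        simp [Nat.mod_eq_of_lt (b i).2]
    exact fun v => DFunLike.congr_fun h v
  rintro x -
  induction x using TensorProduct.induction_on with
  | zero => exact R.zero_mem
  | add x y hx hy => exact R.add_mem hx hy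
  | tmul c s =>
    have h : R.mkQ ((1 : ℂ[T;T⁻¹]) ⊗ₜ s) = 0 := DFunLike.congr_fun hg s
    rw [Submodule.mkQ_apply, Submodule.Quotient.mk_eq_zero] at h
    have := R.smul_mem c h
    rwa [TensorProduct.smul_tmul', smul_eq_mul, mul_one] at this

/-- The polynomial `∑ v_j x_i^j`. -/
def vecPoly (i : Fin k) : (Fin n → ℂ) →ₗ[ℂ] MvPolynomial (Fin k) ℂ[T;T⁻¹] :=
  ∑ j : Fin n, (LinearMap.proj j).smulRight (MvPolynomial.X i ^ (j : ℕ))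

theorem vecPoly_resVec (i : Fin k) (a : ℕ) :
    vecPoly i (resVec hn a) = MvPolynomial.X i ^ (a % n) := by
  simp [vecPoly, resVec, Pi.single_apply]

/-- The multilinear map `v ↦ ∑_σ ∏ᵢ vᵢ(x_{σ i})`. -/
def symmetrizer : MultilinearMap ℂ (fun _ : Fin k => Fin n → ℂ)
    (MvPolynomial (Fin k) ℂ[T;T⁻¹]) :=
  ∑ e : Equiv.Perm (Fin k), (MultilinearMap.mkPiAlgebra ℂ (Fin k)
    (MvPolynomial (Fin k) ℂ[T;T⁻¹])).compLinearMap fun i => vecPoly (e i)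

theorem symmetrizer_apply (v : Fin k → Fin n → ℂ) :
    symmetrizer v = ∑ e : Equiv.Perm (Fin k), ∏ i, vecPoly (e i) (v i) := by
  simp [symmetrizer]

theorem symmetrizer_perm (e : Equiv.Perm (Fin k)) (v : Fin k → Fin n → ℂ) :
    symmetrizer (fun i => v (e i)) = symmetrizer v := by
  rw [symmetrizer_apply, symmetrizer_apply, ← Equiv.sum_comp (Equiv.mulRight e)]
  refine Finset.sum_congr rfl fun s _ => ?_
  exact Equiv.prod_comp e fun i => vecPoly (s i) (v i)

theorem lift_symmetrizer_perm (e : Equiv.Perm (Fin k)) (v : Fin k → Fin n → ℂ) :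
    PiTensorProduct.lift symmetrizer (PiTensorProduct.tprod ℂ v) =
      PiTensorProduct.lift symmetrizer (PiTensorProduct.tprod ℂ fun i => v (e i)) := by
  rw [PiTensorProduct.lift.tprod, PiTensorProduct.lift.tprod, symmetrizer_perm]

/-- The map `S^k(ℂ^n) → ℂ[z,z⁻¹][x₁,…,x_k]` induced by `symmetrizer`. -/
def symmetrize : SymPow n k →ₗ[ℂ] MvPolynomial (Fin k) ℂ[T;T⁻¹] where
  toFun := AddCon.lift (addConGen (SymmetricPower.Rel ℂ (Fin k) (Fin n → ℂ)))
    ((PiTensorProduct.lift symmetrizer).toAddMonoidHom) (by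
      rw [AddCon.addConGen_le]
      rintro _ _ ⟨e, v⟩
      exact lift_symmetrizer_perm e v)
  map_add' := map_add _
  map_smul' c x := by
    induction x using AddCon.induction_on with
    | H x => exact map_smul (PiTensorProduct.lift symmetrizer) c x

theorem symmetrize_tprod (v : Fin k → Fin n → ℂ) :
    symmetrize (SymmetricPower.tprod ℂ v) = symmetrizer v :=
  PiTensorProduct.lift.tprod (φ := symmetrizer) v

theorem X_pow_sub_mem_rootIdeal {A : Type} [CommRing A] (z : A) (i : Fin k) (a : ℕ) :
    (MvPolynomial.X i ^ a - MvPolynomial.C (z ^ (a / n)) * MvPolynomial.X i ^ (a % n) :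
      MvPolynomial (Fin k) A) ∈ rootIdeal z n k := by
  rw [← Ideal.Quotient.mk_eq_mk_iff_sub_mem]
  have h : Ideal.Quotient.mk (rootIdeal z n k) (MvPolynomial.X i ^ n) =
      Ideal.Quotient.mk _ (MvPolynomial.C z) :=
    Ideal.Quotient.mk_eq_mk_iff_sub_mem _ _ |>.2 (Ideal.subset_span ⟨i, rfl⟩)
  conv_lhs => rw [← Nat.div_add_mod a n, pow_add, pow_mul, map_mul, map_pow, h]
  simp

/-- Symmetrizing after `monMap` is the sum over all permutations, modulo `rootIdeal`. -/
theorem symmetrize_monMap_sub_mem (f : MvPolynomial (Fin k) ℂ[T;T⁻¹]) :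
    permSum ℂ[T;T⁻¹] k f - symmetrize.liftBaseChange ℂ[T;T⁻¹] (monMap k hn f) ∈
      rootIdeal (LaurentPolynomial.T 1 : ℂ[T;T⁻¹]) n k := by
  induction f using MvPolynomial.induction_on' with
  | add p q hp hq =>
    rw [map_add, map_add, map_add, add_sub_add_comm]
    exact add_mem hp hq
  | monomial a c =>
    have h : MvPolynomial.monomial a c = c • ∏ i, (MvPolynomial.X i ^ a i :
        MvPolynomial (Fin k) ℂ[T;T⁻¹]) := by
      rw [MvPolynomial.monomial_eq, Finsupp.prod_fintype _ _ (by simp), MvPolynomial.smul_eq_C_mul]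
    rw [monMap_monomial, map_smul, h, map_smul, ← smul_sub, MvPolynomial.smul_eq_C_mul]
    refine Ideal.mul_mem_left _ _ ?_
    rw [monVec, LinearMap.liftBaseChange_tmul, symmetrize_tprod, symmetrizer_apply, permSum_apply,
      Finset.smul_sum, ← Finset.sum_sub_distrib]
    refine sum_mem fun e _ => ?_
    -- Distributing the power of z over the variables lets the two products be compared factor by
    -- factor modulo `rootIdeal`, where x_i^n = z.
    have h1 : (LaurentPolynomial.T (∑ i, ((a i / n : ℕ) : ℤ)) : ℂ[T;T⁻¹]) =
        ∏ i, (LaurentPolynomial.T 1) ^ (a i / n) := by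
      rw [Finset.prod_pow_eq_pow_sum, LaurentPolynomial.T_pow]
      simp
    rw [h1, MvPolynomial.smul_eq_C_mul, map_prod, map_prod, ← Finset.prod_mul_distrib,
      ← Ideal.Quotient.mk_eq_mk_iff_sub_mem, map_prod, map_prod]
    refine Finset.prod_congr rfl fun i _ => ?_
    rw [vecPoly_resVec, map_pow, MvPolynomial.rename_X, Ideal.Quotient.mk_eq_mk_iff_sub_mem]
    exact X_pow_sub_mem_rootIdeal _ _ _

end Operators

/-! ### The action of symmetric polynomials, its kernel, and the isomorphism. -/

section Isomorphism

open MvPolynomial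

variable {n k : ℕ} (hn : 1 ≤ n)

/-- The f whose multiplication descends along `monMap` form a subalgebra containing the power sums,
hence everything; the kernel of `monMap` need not be computed. -/
theorem exists_symAct (f : symmetricSubalgebra (Fin k) ℂ[T;T⁻¹]) :
    ∃ F : Module.End ℂ[T;T⁻¹] (LoopSym n k), ∀ g,
      F (monMap k hn g) = monMap k hn ((f : MvPolynomial (Fin k) ℂ[T;T⁻¹]) * g) := by
  have hf : f ∈ Algebra.adjoin ℂ[T;T⁻¹] (Set.range (powerSum ℂ[T;T⁻¹] k)) := by
    rw [adjoin_powerSum]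
    trivial
  induction hf using Algebra.adjoin_induction with
  | mem x hx =>
    obtain ⟨r, rfl⟩ := hx
    exact ⟨principalOp n k hn r, fun g => (monMap_psum_mul hn r g).symm⟩
  | algebraMap c =>
    refine ⟨c • LinearMap.id, fun g => ?_⟩
    rw [LinearMap.smul_apply, LinearMap.id_apply, ← map_smul, MvPolynomial.smul_eq_C_mul]
    rfl
  | add x y _ _ hx hy =>
    obtain ⟨F, hF⟩ := hx
    obtain ⟨G, hG⟩ := hy
    exact ⟨F + G, fun g => by
      rw [LinearMap.add_apply, hF, hG, ← map_add, ← add_mul]; rfl⟩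
  | mul x y _ _ hx hy =>
    obtain ⟨F, hF⟩ := hx
    obtain ⟨G, hG⟩ := hy
    exact ⟨F * G, fun g => by
      rw [Module.End.mul_apply, hG, hF, ← mul_assoc]; rfl⟩

theorem end_ext_of_monMap {F G : Module.End ℂ[T;T⁻¹] (LoopSym n k)}
    (h : ∀ g, F (monMap k hn g) = G (monMap k hn g)) : F = G := by
  refine LinearMap.ext fun x => ?_
  obtain ⟨g, rfl⟩ := monMap_surjective hn x
  exact h g

variable (k) in
/-- The action of the symmetric polynomials on `ℂ[z,z⁻¹] ⊗ S^k(ℂ^n)` that is compatible with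
multiplication of polynomials along `monMap`. -/
def symAct : symmetricSubalgebra (Fin k) ℂ[T;T⁻¹] →ₐ[ℂ[T;T⁻¹]]
    Module.End ℂ[T;T⁻¹] (LoopSym n k) :=
  -- Since `monMap` is surjective, the chosen operator is determined by f, so each algebra identity
  -- can be checked on images of polynomials.
  AlgHom.ofLinearMap
    { toFun := fun f => (exists_symAct hn f).choose
      map_add' := fun x y => end_ext_of_monMap hn fun g => by
        rw [LinearMap.add_apply, (exists_symAct hn x).choose_spec,
          (exists_symAct hn y).choose_spec, (exists_symAct hn (x + y)).choose_spec, ← map_add,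
          ← add_mul]
        rfl
      map_smul' := fun c x => end_ext_of_monMap hn fun g => by
        rw [RingHom.id_apply, LinearMap.smul_apply, (exists_symAct hn x).choose_spec,
          (exists_symAct hn (c • x)).choose_spec, ← map_smul, ← smul_mul_assoc]
        rfl }
    (end_ext_of_monMap hn fun g => by
      change (exists_symAct hn 1).choose _ = _
      rw [(exists_symAct hn 1).choose_spec, Module.End.one_apply]
      congr 1
      exact one_mul g)
    (fun x y => end_ext_of_monMap hn fun g => by
      change (exists_symAct hn (x * y)).choose _ =
        (exists_symAct hn x).choose ((exists_symAct hn y).choose _)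
      rw [(exists_symAct hn (x * y)).choose_spec, (exists_symAct hn y).choose_spec,
        (exists_symAct hn x).choose_spec, ← mul_assoc]
      rfl)

theorem symAct_monMap (f : symmetricSubalgebra (Fin k) ℂ[T;T⁻¹])
    (g : MvPolynomial (Fin k) ℂ[T;T⁻¹]) :
    symAct k hn f (monMap k hn g) =
      monMap k hn ((f : MvPolynomial (Fin k) ℂ[T;T⁻¹]) * g) :=
  (exists_symAct hn f).choose_spec g

theorem symAct_powerSum (r : ℕ) :
    symAct k hn (powerSum ℂ[T;T⁻¹] k r) = principalOp n k hn r :=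
  end_ext_of_monMap hn fun g => by
    rw [symAct_monMap]
    exact monMap_psum_mul hn r g

/-- The kernel of the action is `verlindeIdeal`. -/
theorem symAct_eq_zero_iff (f : symmetricSubalgebra (Fin k) ℂ[T;T⁻¹]) :
    symAct k hn f = 0 ↔ f ∈ verlindeIdeal ℂ[T;T⁻¹] (LaurentPolynomial.T 1) n k := by
  constructor
  · intro h
    -- Testing on the image of 1 suffices: it gives `monMap` f = 0.
    have h1 := symAct_monMap hn f 1
    rw [h, mul_one, LinearMap.zero_apply] at h1
    have h2 := symmetrize_monMap_sub_mem hn (f : MvPolynomial (Fin k) ℂ[T;T⁻¹])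
    rw [← h1, map_zero, sub_zero] at h2
    exact mem_verlindeIdeal_of_permSum_mem h2
  · intro h
    suffices hle : verlindeIdeal ℂ[T;T⁻¹] (LaurentPolynomial.T 1) n k ≤
        RingHom.ker (symAct k hn) from hle h
    rw [verlindeIdeal, Ideal.span_le]
    rintro _ ⟨i, rfl⟩
    rw [SetLike.mem_coe, RingHom.mem_ker, map_sub, map_smul, symAct_powerSum, symAct_powerSum,
      sub_eq_zero]
    have := principalOp_add_mul (k := k) hn (i : ℕ) 1
    rw [one_mul, add_comm] at this
    exact_mod_cast this

/-- The ring is generated over ℂ only; multiplication by z^m is recovered as k⁻¹ P_(mn), which needs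
k ≠ 0. -/
theorem smul_one_mem_principalRing (hk : 1 ≤ k) (c : ℂ[T;T⁻¹]) :
    c • (1 : Module.End ℂ[T;T⁻¹] (LoopSym n k)) ∈ principalRing n k hn := by
  induction c using LaurentPolynomial.induction_on' with
  | add p q hp hq =>
    rw [add_smul]
    exact add_mem hp hq
  | C_mul_T m a =>
    have h : principalOp n k hn (m * n) ∈ principalRing n k hn :=
      Algebra.subset_adjoin ⟨_, rfl⟩
    have h' := (principalRing n k hn).smul_mem h (a * (k : ℂ)⁻¹)
    have hk' : (k : ℂ) ≠ 0 := by exact_mod_cast (by omega : k ≠ 0)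
    rw [principalOp_mul, ← smul_assoc, ← Module.End.one_eq_id] at h'
    convert h' using 2
    have hc : (k : ℂ[T;T⁻¹]) = LaurentPolynomial.C (k : ℂ) := by simp
    have hs : ∀ (b : ℂ) (p : ℂ[T;T⁻¹]), b • p = LaurentPolynomial.C b * p := fun b p => by
      rw [Algebra.smul_def]; rfl
    rw [hs, hc, mul_comm (LaurentPolynomial.T m), ← mul_assoc, ← map_mul, inv_mul_cancel_right₀ hk']

theorem symAct_mem_principalRing (hk : 1 ≤ k) (f : symmetricSubalgebra (Fin k) ℂ[T;T⁻¹]) :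
    symAct k hn f ∈ principalRing n k hn := by
  have hf : f ∈ Algebra.adjoin ℂ[T;T⁻¹] (Set.range (powerSum ℂ[T;T⁻¹] k)) := by
    rw [adjoin_powerSum]
    trivial
  induction hf using Algebra.adjoin_induction with
  | mem x hx =>
    obtain ⟨r, rfl⟩ := hx
    rw [symAct_powerSum]
    exact Algebra.subset_adjoin ⟨_, rfl⟩
  | algebraMap c =>
    rw [AlgHom.commutes, Algebra.algebraMap_eq_smul_one]
    exact smul_one_mem_principalRing hn hk c
  | add x y _ _ hx hy => rw [map_add]; exact add_mem hx hy
  | mul x y _ _ hx hy => rw [map_mul]; exact mul_mem hx hy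

/-- Euclidean division of r by n brings negative indices back to genuine power sums, so every
generator lies in the image of `symAct`. -/
theorem principalOp_eq_symAct (r : ℤ) :
    principalOp n k hn r = symAct k hn
      ((LaurentPolynomial.T (r / n) : ℂ[T;T⁻¹]) • powerSum ℂ[T;T⁻¹] k (r % n).toNat) := by
  have h : ((r % n).toNat : ℤ) = r % n := Int.toNat_of_nonneg (Int.emod_nonneg r (by omega))
  rw [map_smul, symAct_powerSum, ← principalOp_add_mul, h, mul_comm, Int.emod_add_mul_ediv]

theorem exists_symAct_eq {F : Module.End ℂ[T;T⁻¹] (LoopSym n k)}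
    (hF : F ∈ principalRing n k hn) : ∃ f, symAct k hn f = F := by
  have h : principalRing n k hn ≤ ((symAct k hn).restrictScalars ℂ).range := by
    refine Algebra.adjoin_le ?_
    rintro _ ⟨r, rfl⟩
    exact ⟨_, (principalOp_eq_symAct hn r).symm⟩
  exact h hF

theorem principalRing_mul_comm {F G : Module.End ℂ[T;T⁻¹] (LoopSym n k)}
    (hF : F ∈ principalRing n k hn) (hG : G ∈ principalRing n k hn) : F * G = G * F := by
  obtain ⟨f, rfl⟩ := exists_symAct_eq hn hF
  obtain ⟨g, rfl⟩ := exists_symAct_eq hn hG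
  rw [← map_mul, ← map_mul, mul_comm]

/-- The action of the generalised Verlinde algebra on `ℂ[z,z⁻¹] ⊗ S^k(ℂ^n)`. -/
def verlindeAct (hk : 1 ≤ k) : Verlinde n k →ₐ[ℂ] principalRing n k hn :=
  Ideal.Quotient.liftₐ (verlindeIdeal ℂ[T;T⁻¹] (LaurentPolynomial.T 1) n k)
    (((symAct k hn).restrictScalars ℂ).codRestrict (principalRing n k hn)
      (symAct_mem_principalRing hn hk))
    fun f hf => Subtype.ext ((symAct_eq_zero_iff hn f).2 hf)

/-- The class of a symmetric polynomial in the generalised Verlinde algebra. -/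
def verlindeMk (n k : ℕ) (f : symmetricSubalgebra (Fin k) ℂ[T;T⁻¹]) : Verlinde n k :=
  Ideal.Quotient.mk (verlindeIdeal ℂ[T;T⁻¹] (LaurentPolynomial.T 1) n k) f

theorem coe_verlindeAct_mk (hk : 1 ≤ k) (f : symmetricSubalgebra (Fin k) ℂ[T;T⁻¹]) :
    (verlindeAct hn hk (verlindeMk n k f) : Module.End ℂ[T;T⁻¹] (LoopSym n k)) =
      symAct k hn f := rfl

theorem verlindeAct_bijective (hk : 1 ≤ k) : Function.Bijective (verlindeAct (n := n) hn hk) := by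
  constructor
  · rw [injective_iff_map_eq_zero]
    intro x hx
    obtain ⟨f, rfl⟩ : ∃ f, verlindeMk n k f = x := Ideal.Quotient.mk_surjective x
    have h := congrArg Subtype.val hx
    rw [coe_verlindeAct_mk] at h
    exact Ideal.Quotient.eq_zero_iff_mem.2 ((symAct_eq_zero_iff hn f).1 h)
  · rintro ⟨F, hF⟩
    obtain ⟨f, rfl⟩ := exists_symAct_eq hn hF
    exact ⟨verlindeMk n k f, rfl⟩

/-- The ring of principal operators is isomorphic to the generalised Verlinde algebra. -/
def principalRingEquiv (hk : 1 ≤ k) : principalRing n k hn ≃ₐ[ℂ] Verlinde n k :=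
  (AlgEquiv.ofBijective (verlindeAct hn hk) (verlindeAct_bijective hn hk)).symm

theorem principalRingEquiv_eq (hk : 1 ≤ k) {F : principalRing n k hn}
    {f : symmetricSubalgebra (Fin k) ℂ[T;T⁻¹]} (h : F.1 = symAct k hn f) :
    principalRingEquiv hn hk F = verlindeMk n k f := by
  rw [principalRingEquiv, AlgEquiv.symm_apply_eq]
  exact Subtype.ext h

/-- The factor P_(mn) contributes z^m k, so after division by k every generator is a product of the
two kinds on which the isomorphism is prescribed. -/
theorem principalGen_mul (r : ℤ) :
    principalGen n k hn (r / n * n) * principalGen n k hn (r % n) =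
      (k : ℂ) • principalGen n k hn r := by
  ext1
  change principalOp n k hn (r / n * n) * principalOp n k hn (r % n) =
    (k : ℂ) • principalOp n k hn r
  conv_rhs => rw [← Int.emod_add_ediv_mul r n, principalOp_add_mul]
  rw [principalOp_mul, ← Module.End.one_eq_id, smul_one_mul, mul_comm, mul_smul,
    Nat.cast_smul_eq_nsmul, Nat.cast_smul_eq_nsmul]

theorem principalRing_algHom_ext (hk : 1 ≤ k) {B : Type} [Semiring B] [Algebra ℂ B]
    {φ ψ : principalRing n k hn →ₐ[ℂ] B}
    (h₁ : ∀ r : ℕ, 1 ≤ r → r < n → φ (principalGen n k hn r) = ψ (principalGen n k hn r))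
    (h₂ : ∀ m : ℤ, φ (principalGen n k hn (m * n)) = ψ (principalGen n k hn (m * n))) :
    φ = ψ := by
  refine AlgHom.adjoin_ext ?_
  rintro _ ⟨r, rfl⟩
  change φ (principalGen n k hn r) = ψ (principalGen n k hn r)
  have hk' : (k : ℂ) ≠ 0 := by exact_mod_cast (by omega : k ≠ 0)
  have hr : φ (principalGen n k hn (r % n)) = ψ (principalGen n k hn (r % n)) := by
    have h := Int.emod_nonneg r (by omega : (n : ℤ) ≠ 0)
    have h' := Int.emod_lt_of_pos r (by omega : (0 : ℤ) < n)
    -- Residue 0 is the operator P_0 = k Id, covered by the prescription at m = 0.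
    rcases h.eq_or_lt with h0 | h0
    · rw [← h0]
      simpa using h₂ 0
    · have := h₁ (r % n).toNat (by omega) (by omega)
      rwa [Int.toNat_of_nonneg h] at this
  have : (k : ℂ) • φ (principalGen n k hn r) = (k : ℂ) • ψ (principalGen n k hn r) := by
    rw [← map_smul, ← map_smul, ← principalGen_mul, map_mul, map_mul, h₂, hr]
  simpa [smul_smul, hk'] using congrArg ((k : ℂ)⁻¹ • ·) this

end Isomorphism

end GenVerlinde

end

theorem mainTheorem4 (n k : ℕ) (hn : 1 ≤ n) (hk : 1 ≤ k) :
    (∀ x ∈ GenVerlinde.principalRing n k hn, ∀ y ∈ GenVerlinde.principalRing n k hn,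
      x * y = y * x) ∧
    ∃! φ : GenVerlinde.principalRing n k hn ≃ₐ[ℂ] GenVerlinde.Verlinde n k,
      (∀ r : ℕ, 1 ≤ r → r < n →
        φ (GenVerlinde.principalGen n k hn r) = GenVerlinde.pClass n k r ∧
        φ (GenVerlinde.principalGen n k hn (-r)) =
          (LaurentPolynomial.T (-1) : LaurentPolynomial ℂ) • GenVerlinde.pClass n k (n - r)) ∧
      ∀ m : ℤ, φ (GenVerlinde.principalGen n k hn (m * n)) =
        algebraMap (LaurentPolynomial ℂ) (GenVerlinde.Verlinde n k)
          (LaurentPolynomial.T m * (k : LaurentPolynomial ℂ)) := by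
  refine ⟨fun x hx y hy => GenVerlinde.principalRing_mul_comm hn hx hy,
    GenVerlinde.principalRingEquiv hn hk, ⟨fun r h1 h2 => ⟨?_, ?_⟩, fun m => ?_⟩, ?_⟩
  · exact GenVerlinde.principalRingEquiv_eq hn hk (GenVerlinde.symAct_powerSum hn r).symm
  · refine GenVerlinde.principalRingEquiv_eq hn hk (f := (LaurentPolynomial.T (-1) :
      LaurentPolynomial ℂ) • GenVerlinde.powerSum (LaurentPolynomial ℂ) k (n - r)) ?_
    -- Here -r = (n - r) + (-1)·n; the truncated subtraction is exact because r < n.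
    rw [map_smul, GenVerlinde.symAct_powerSum, ← GenVerlinde.principalOp_add_mul]
    change GenVerlinde.principalOp n k hn (-r) = _
    congr 1
    omega
  · refine GenVerlinde.principalRingEquiv_eq hn hk (f := algebraMap _ _
      (LaurentPolynomial.T m * (k : LaurentPolynomial ℂ))) ?_
    rw [AlgHom.commutes]
    exact GenVerlinde.principalOp_mul hn m
  · rintro φ ⟨h1, h2⟩
    have h : (φ : GenVerlinde.principalRing n k hn →ₐ[ℂ] GenVerlinde.Verlinde n k) =
        (GenVerlinde.principalRingEquiv hn hk : _ →ₐ[ℂ] _) := by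
      refine GenVerlinde.principalRing_algHom_ext hn hk (fun r hr hr' => ?_) fun m => ?_
      · exact (h1 r hr hr').1.trans (GenVerlinde.principalRingEquiv_eq hn hk
          (GenVerlinde.symAct_powerSum hn r).symm).symm
      · refine (h2 m).trans (GenVerlinde.principalRingEquiv_eq hn hk (f := algebraMap _ _
          (LaurentPolynomial.T m * (k : LaurentPolynomial ℂ))) ?_).symm
        rw [AlgHom.commutes]
        exact GenVerlinde.principalOp_mul hn m
    exact AlgEquiv.ext fun x => DFunLike.congr_fun h x
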